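/- Let $E$ be a complex Banach space contained in a complex Hilbert space $L$ with inner product $\langle\cdot,\cdot\rangle$, such that the inclusion $E\hookrightarrow L$ is continuous with dense range. A bounded operator $T$ on $E$ is called \emph{proper} if for every $f\in E$ there is $g\in E$ such that $\langle Th,f\rangle=\langle h,g\rangle$ for all $h\in E$; the vector $g$ is then unique, and $T^+f:=g$ defines a bounded operator $T^+$ on $E$. A proper operator $T$ is called \emph{symmetrizable} if $T^+=T$. A proper projection is a proper operator $Q$ with $Q^2=Q$. A closed subspace $S$ of $E$ is called \emph{proper} if it is the range of a proper projection, and \emph{compatible} if it is the range of a proper projection $Q$ with $Q^+=Q$. Let $S$ be a proper subspace of $E$ which is not compatible, let $Q$ be any proper projection with range $S$, and let $V=2Q-I$. Then $V$ is proper, $X=VV^+$ is a symmetrizable operator, and the spectrum $\sigma_E(X)$ of $X$ as a bounded operator on $E$ contains a non-real point. -/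

import Mathlib

/-! # Operators on a Banach space continuously included in a Hilbert space

`E` is a complex Banach space, `L` a complex Hilbert space and `ι : E →L[ℂ] L` the (injective)
inclusion.  Mathlib's inner product is conjugate-linear in the first variable. -/

section ProperOperators

variable {E L : Type*} [NormedAddCommGroup E] [NormedSpace ℂ E]
  [NormedAddCommGroup L] [InnerProductSpace ℂ L]

/-- A bounded operator `T` on `E` is proper if it admits an adjoint with respect to the inner
product of `L`: for every `f ∈ E` there is `g ∈ E` with `⟪T h, f⟫ = ⟪h, g⟫` for all `h ∈ E`. -/
def IsProperOperator (ι : E →L[ℂ] L) (T : E →L[ℂ] E) : Prop :=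
  ∀ f : E, ∃ g : E, ∀ h : E, inner ℂ (ι (T h)) (ι f) = inner ℂ (ι h) (ι g)

/-- The vector `g` in the definition of a proper operator is unique. -/
theorem eq_of_forall_inner_inclusion_eq {ι : E →L[ℂ] L} (hι : Function.Injective ι) {g g' : E}
    (H : ∀ h : E, inner ℂ (ι h) (ι g) = inner ℂ (ι h) (ι g')) : g = g' := by
  have h1 := H (g - g')
  rw [← sub_eq_zero, ← inner_sub_right, ← map_sub, inner_self_eq_zero] at h1
  have h2 : ι (g - g') = ι 0 := by rw [h1, map_zero]
  exact sub_eq_zero.mp (hι h2)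

/-- The map `f ↦ g` given by the definition of a proper operator, as a linear map. -/
noncomputable def properAdjointLinear (ι : E →L[ℂ] L) (hι : Function.Injective ι)
    (T : E →L[ℂ] E) (hT : IsProperOperator ι T) : E →ₗ[ℂ] E where
  toFun f := Classical.choose (hT f)
  map_add' f₁ f₂ := by
    refine eq_of_forall_inner_inclusion_eq hι fun h => ?_
    rw [← Classical.choose_spec (hT (f₁ + f₂)) h, map_add, inner_add_right,
      Classical.choose_spec (hT f₁) h, Classical.choose_spec (hT f₂) h, ← inner_add_right,
      ← map_add]
  map_smul' c f := by
    refine eq_of_forall_inner_inclusion_eq hι fun h => ?_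
    rw [← Classical.choose_spec (hT (c • f)) h, map_smul, inner_smul_right,
      Classical.choose_spec (hT f) h, ← inner_smul_right, ← map_smul, RingHom.id_apply]

theorem properAdjointLinear_spec (ι : E →L[ℂ] L) (hι : Function.Injective ι)
    (T : E →L[ℂ] E) (hT : IsProperOperator ι T) (h f : E) :
    inner ℂ (ι (T h)) (ι f) = inner ℂ (ι h) (ι (properAdjointLinear ι hι T hT f)) :=
  Classical.choose_spec (hT f) h

variable [CompleteSpace E]

/-- The adjoint `T⁺` of a proper operator `T`, as a bounded operator on `E`
(bounded by the closed graph theorem). -/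
noncomputable def properAdjoint (ι : E →L[ℂ] L) (hι : Function.Injective ι)
    (T : E →L[ℂ] E) (hT : IsProperOperator ι T) : E →L[ℂ] E :=
  ContinuousLinearMap.ofSeqClosedGraph (g := properAdjointLinear ι hι T hT) (by
    intro u x y hu hgu
    refine eq_of_forall_inner_inclusion_eq hι fun h => ?_
    rw [← properAdjointLinear_spec]
    have h1 : Filter.Tendsto (fun n => inner ℂ (ι (T h)) (ι (u n))) Filter.atTop
        (nhds (inner ℂ (ι (T h)) (ι x))) :=
      Filter.Tendsto.inner tendsto_const_nhds ((ι.continuous.tendsto x).comp hu)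
    have h2 : Filter.Tendsto (fun n => inner ℂ (ι h) (ι (properAdjointLinear ι hι T hT (u n))))
        Filter.atTop (nhds (inner ℂ (ι h) (ι y))) :=
      Filter.Tendsto.inner tendsto_const_nhds ((ι.continuous.tendsto y).comp hgu)
    simp only [← properAdjointLinear_spec] at h2
    exact tendsto_nhds_unique h2 h1)

/-- The defining identity `⟪T h, f⟫ = ⟪h, T⁺ f⟫`. -/
theorem properAdjoint_spec (ι : E →L[ℂ] L) (hι : Function.Injective ι)
    (T : E →L[ℂ] E) (hT : IsProperOperator ι T) (h f : E) :
    inner ℂ (ι (T h)) (ι f) = inner ℂ (ι h) (ι (properAdjoint ι hι T hT f)) :=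
  properAdjointLinear_spec ι hι T hT h f

/-- A symmetrizable operator is a proper operator `T` with `T⁺ = T`. -/
def IsSymmetrizable (ι : E →L[ℂ] L) (hι : Function.Injective ι) (T : E →L[ℂ] E) : Prop :=
  ∃ hT : IsProperOperator ι T, properAdjoint ι hι T hT = T

/-- `Q` is a proper projection with range `S`. -/
def IsProperProjectionOnto (ι : E →L[ℂ] L) (Q : E →L[ℂ] E) (S : Submodule ℂ E) : Prop :=
  IsProperOperator ι Q ∧ Q * Q = Q ∧ LinearMap.range (Q : E →ₗ[ℂ] E) = S

/-- A closed subspace of `E` is proper if it is the range of a proper projection. -/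
def IsProperSubspace (ι : E →L[ℂ] L) (S : Submodule ℂ E) : Prop :=
  IsClosed (S : Set E) ∧ ∃ Q : E →L[ℂ] E, IsProperProjectionOnto ι Q S

/-- A closed subspace of `E` is compatible if it is the range of a proper projection `Q`
with `Q⁺ = Q`. -/
def IsCompatibleSubspace (ι : E →L[ℂ] L) (hι : Function.Injective ι) (S : Submodule ℂ E) : Prop :=
  IsClosed (S : Set E) ∧
    ∃ Q : E →L[ℂ] E, IsProperProjectionOnto ι Q S ∧ IsSymmetrizable ι hι Q

end ProperOperators

/-! Write `X = V V⁺`. Since `V² = 1`, `V (1 + X) = V + V⁺ = 2 (Q + Q⁺ - 1)`. If `-1` were outside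
the spectrum of `X`, then `Q + Q⁺ - 1` would have an inverse `B`, and `Q B` would be a symmetrizable
projection onto `S`, against incompatibility. So `-1` lies in the spectrum on `E`. On `L`, however,
`X` extends to some `W* W`, whose spectrum is nonnegative. If the spectrum on `E` were real, a
circle around `-1` in the left half-plane could cross the axis only at regular points of `X`; the
Cauchy integral of the resolvent of `X` along it would then invert `-1 - X` on `E`, a contradiction.
-/

section TwoNorms

variable {E L : Type*} [NormedAddCommGroup E] [NormedSpace ℂ E]

/-- If `Y` on `L` extends `X` on `E`, and a closed disc lies in the resolvent set of `Y` while its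
boundary circle lies in the resolvent set of `X`, then the disc lies in the resolvent set of `X`. -/
theorem mem_resolventSet_of_sphere_subset [CompleteSpace E]
    [NormedAddCommGroup L] [NormedSpace ℂ L] [CompleteSpace L]
    {ι : E →L[ℂ] L} (hι : Function.Injective ι) {X : E →L[ℂ] E} {Y : L →L[ℂ] L}
    (hXY : ∀ x, Y (ι x) = ι (X x)) {c w : ℂ} {r : ℝ}
    (hY : Metric.closedBall c r ⊆ resolventSet ℂ Y) (hX : Metric.sphere c r ⊆ resolventSet ℂ X)
    (hw : w ∈ Metric.ball c r) : w ∈ resolventSet ℂ X := by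
  have hr : 0 < r := dist_nonneg.trans_lt (Metric.mem_ball.mp hw)
  have key : ∀ z ∈ resolventSet ℂ X, z ∈ resolventSet ℂ Y →
      ι.comp (resolvent X z) = (resolvent Y z).comp ι := by
    intro z hzX hzY
    ext f
    have h1 : (algebraMap ℂ (E →L[ℂ] E) z - X) * resolvent X z = 1 :=
      Ring.mul_inverse_cancel _ hzX
    have h2 : resolvent Y z * (algebraMap ℂ (L →L[ℂ] L) z - Y) = 1 :=
      Ring.inverse_mul_cancel _ hzY
    have h1' := congrArg ι (DFunLike.congr_fun h1 f)
    have h2' := DFunLike.congr_fun h2 (ι (resolvent X z f))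
    simp only [mul_apply_eq_comp, one_apply_eq_self,
      sub_apply, Algebra.algebraMap_eq_smul_one,
      smul_apply, map_sub, map_smul] at h1' h2'
    rw [← map_smul (resolvent Y z), ← map_sub, hXY, h1'] at h2'
    exact h2'.symm
  -- Both resolvents are compared as operators from `E` to `L`, where `key` makes them agree.
  set Φ : (E →L[ℂ] E) →L[ℂ] (E →L[ℂ] L) := ContinuousLinearMap.compL ℂ E E L ι
  set Ψ : (L →L[ℂ] L) →L[ℂ] (E →L[ℂ] L) := (ContinuousLinearMap.compL ℂ E L L).flip ι
  have hcont : ContinuousOn (fun z => (z - w)⁻¹ • resolvent X z) (Metric.sphere c r) := by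
    refine ContinuousOn.smul (ContinuousOn.inv₀ (continuous_id.sub continuous_const).continuousOn ?_)
      fun z hz =>
      (spectrum.hasDerivAt_resolvent_const_left (hX hz)).continuousAt.continuousWithinAt
    rintro z hz h0
    obtain rfl : z = w := sub_eq_zero.mp h0
    exact (Metric.mem_ball.mp hw).ne hz
  have hint : CircleIntegrable (fun z => (z - w)⁻¹ • resolvent X z) c r :=
    hcont.circleIntegrable hr.le
  -- Only values on the circle enter, so `G` maps into `E` before `w` is known to be regular for
  -- `X`.
  set G : E →L[ℂ] E :=
    (2 * Real.pi * Complex.I : ℂ)⁻¹ • circleIntegral (fun z => (z - w)⁻¹ • resolvent X z) c r with hG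
  have hdiff : DifferentiableOn ℂ (fun z => Ψ (resolvent Y z)) (Metric.closedBall c r) :=
    fun z hz => (Ψ.differentiableAt.comp z
      (spectrum.hasDerivAt_resolvent_const_left (hY hz)).differentiableAt).differentiableWithinAt
  have hΦG : Φ G = Ψ (resolvent Y w) := by
    have hcauchy := hdiff.circleIntegral_sub_inv_smul hw
    have h1 : Φ (circleIntegral (fun z => (z - w)⁻¹ • resolvent X z) c r) =
        circleIntegral (fun z => (z - w)⁻¹ • Ψ (resolvent Y z)) c r := by
      rw [circleIntegral, ← Φ.intervalIntegral_comp_comm hint.out]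
      refine Eq.trans ?_ (circleIntegral.integral_congr hr.le
        (f := fun z => (z - w)⁻¹ • Φ (resolvent X z)) fun z hz => ?_)
      · simp only [circleIntegral, map_smul]
      · exact congrArg _ (key z (hX hz) (hY (Metric.sphere_subset_closedBall hz)))
    rw [hG, map_smul, h1, hcauchy, inv_smul_smul₀]
    simp [Real.pi_ne_zero, Complex.I_ne_zero]
  have hwY := hY (Metric.ball_subset_closedBall hw)
  have hG' : ∀ f, ι (G f) = resolvent Y w (ι f) := fun f => DFunLike.congr_fun hΦG f
  have h1 : (algebraMap ℂ (L →L[ℂ] L) w - Y) * resolvent Y w = 1 :=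
    Ring.mul_inverse_cancel _ hwY
  have h2 : resolvent Y w * (algebraMap ℂ (L →L[ℂ] L) w - Y) = 1 :=
    Ring.inverse_mul_cancel _ hwY
  have hι' : ∀ f, ι ((algebraMap ℂ (E →L[ℂ] E) w - X) f) =
      (algebraMap ℂ (L →L[ℂ] L) w - Y) (ι f) := fun f => by
    simp [Algebra.algebraMap_eq_smul_one, hXY]
  refine isUnit_iff_exists.mpr ⟨G, ?_, ?_⟩
  · ext f
    apply hι
    rw [mul_apply_eq_comp, hι', hG']
    exact DFunLike.congr_fun h1 (ι f)
  · ext f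
    apply hι
    rw [mul_apply_eq_comp, hG', hι']
    exact DFunLike.congr_fun h2 (ι f)

variable [NormedAddCommGroup L] [InnerProductSpace ℂ L]

/-- `T'` is an adjoint of `T` with respect to the inner product of `L`. -/
def IsAdjointPairAlong (ι : E →L[ℂ] L) (T T' : E →L[ℂ] E) : Prop :=
  ∀ h f : E, inner ℂ (ι (T h)) (ι f) = inner ℂ (ι h) (ι (T' f))

namespace IsAdjointPairAlong

variable {ι : E →L[ℂ] L} {T T' A A' : E →L[ℂ] E}

theorem isProperOperator (h : IsAdjointPairAlong ι T T') : IsProperOperator ι T :=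
  fun f => ⟨T' f, fun x => h x f⟩

theorem eq (hι : Function.Injective ι) (h : IsAdjointPairAlong ι T T')
    (h' : IsAdjointPairAlong ι T A) : T' = A := by
  ext f
  exact eq_of_forall_inner_inclusion_eq hι fun x => by rw [← h, ← h']

theorem isSymmetrizable [CompleteSpace E] (hι : Function.Injective ι) (h : IsAdjointPairAlong ι T T) :
    IsSymmetrizable ι hι T :=
  ⟨h.isProperOperator, eq hι (properAdjoint_spec ι hι T h.isProperOperator) h⟩

theorem symm (h : IsAdjointPairAlong ι T T') : IsAdjointPairAlong ι T' T := fun x f => by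
  rw [← inner_conj_symm, ← h, inner_conj_symm]

theorem mul (h : IsAdjointPairAlong ι T T') (h' : IsAdjointPairAlong ι A A') :
    IsAdjointPairAlong ι (T * A) (A' * T') := fun x f => by
  simp only [mul_apply_eq_comp]
  rw [h, h']

theorem two_smul_sub_one (h : IsAdjointPairAlong ι T T') :
    IsAdjointPairAlong ι ((2 : ℂ) • T - 1) ((2 : ℂ) • T' - 1) := fun x f => by
  simp only [sub_apply, smul_apply, one_apply_eq_self, map_sub, map_smul, inner_sub_left,
    inner_sub_right, inner_smul_left, inner_smul_right, h x f, map_ofNat]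

theorem add_sub_one (h : IsAdjointPairAlong ι T T') :
    IsAdjointPairAlong ι (T + T' - 1) (T + T' - 1) := fun x f => by
  simp only [sub_apply, add_apply,
    one_apply_eq_self, map_sub, map_add, inner_sub_left, inner_sub_right,
    inner_add_left, inner_add_right, h x f, h.symm x f]
  ring

theorem of_inverse (h : IsAdjointPairAlong ι T T) (h1 : T * A = 1) :
    IsAdjointPairAlong ι A A := fun x f => by
  have hT : ∀ y, T (A y) = y := fun y => DFunLike.congr_fun h1 y
  conv_lhs => rw [← hT f]
  rw [← h, hT]

/-- A symmetrizable operator is bounded for the norm of `L`. -/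
theorem exists_norm_le (h : IsAdjointPairAlong ι T T) :
    ∃ K : ℝ, ∀ f, ‖ι (T f)‖ ≤ K * ‖ι f‖ := by
  -- Cauchy–Schwarz, to be iterated along the powers `T ^ (2 ^ n)`.
  have step : ∀ (A : E →L[ℂ] E), IsAdjointPairAlong ι A A → ∀ f,
      ‖ι (A f)‖ ^ 2 ≤ ‖ι ((A * A) f)‖ * ‖ι f‖ := fun A hA f => by
    have h1 : ‖ι (A f)‖ ^ 2 = ‖inner ℂ (ι ((A * A) f)) (ι f)‖ := by
      rw [mul_apply_eq_comp, hA, inner_self_eq_norm_sq_to_K]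
      simp
    rw [h1]
    exact norm_inner_le_norm _ _
  have hpow : ∀ n : ℕ, IsAdjointPairAlong ι (T ^ n) (T ^ n) := by
    intro n
    induction n with
    | zero => intro x f; simp
    | succ n ih => have := ih.mul h; rwa [← pow_succ, ← pow_succ'] at this
  -- The `+ 1` keeps the constant positive even when `T = 0`. A larger ratio `u` would make `u ^ (2
  -- ^ n)` outgrow the bound from the `E`-norm.
  refine ⟨‖T‖ + 1, fun f => ?_⟩
  by_contra! hlt
  have hK : 0 < ‖T‖ + 1 := by positivity
  have hf : 0 < ‖ι f‖ := by
    refine (norm_nonneg _).lt_of_ne' fun h0 => ?_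
    have := step T h f
    rw [h0, mul_zero] at this hlt
    nlinarith
  set u := ‖ι (T f)‖ / ‖ι f‖ with hu
  have hu0 : 0 ≤ u := by positivity
  have hmain : ∀ n : ℕ, u ^ (2 ^ n) * ‖ι f‖ ≤ ‖ι ((T ^ (2 ^ n)) f)‖ := by
    intro n
    induction n with
    | zero => simp [hu, hf.ne']
    | succ n ih =>
      have h1 := step _ (hpow (2 ^ n)) f
      rw [← pow_add, ← two_mul, ← pow_succ'] at h1
      have h2 : (u ^ (2 ^ n) * ‖ι f‖) ^ 2 ≤ ‖ι ((T ^ (2 ^ (n + 1))) f)‖ * ‖ι f‖ :=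
        (pow_le_pow_left₀ (by positivity) ih 2).trans h1
      refine le_of_mul_le_mul_right (le_trans (le_of_eq ?_) h2) hf
      rw [pow_succ 2 n, pow_mul]
      ring
  have hone : 1 < u / (‖T‖ + 1) := by
    rw [one_lt_div hK, hu, lt_div_iff₀ hf]
    exact hlt
  obtain ⟨n, hn⟩ := pow_unbounded_of_one_lt (‖ι‖ * ‖f‖ / ‖ι f‖) hone
  have hn' := hn.trans_le (pow_le_pow_right₀ hone.le n.lt_two_pow_self.le)
  rw [div_pow, div_lt_div_iff₀ hf (by positivity)] at hn'
  have hbound : ‖ι ((T ^ (2 ^ n)) f)‖ ≤ ‖ι‖ * ((‖T‖ + 1) ^ (2 ^ n) * ‖f‖) := by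
    refine (ι.le_opNorm _).trans (mul_le_mul_of_nonneg_left ?_ (norm_nonneg _))
    refine ((T ^ (2 ^ n)).le_opNorm f).trans (mul_le_mul_of_nonneg_right ?_ (norm_nonneg _))
    exact (norm_pow_le' T (by positivity)).trans
      (pow_le_pow_left₀ (norm_nonneg _) (by linarith) _)
  have := (hmain n).trans hbound
  linarith

/-- A proper operator is bounded for the norm of `L`. -/
theorem exists_norm_le_of_pair (h : IsAdjointPairAlong ι T T') :
    ∃ K : ℝ, ∀ f, ‖ι (T f)‖ ≤ K * ‖ι f‖ := by
  -- `T' * T` is its own adjoint, and `‖ι (T f)‖² = ⟪T' T f, f⟫`.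
  obtain ⟨K, hK⟩ := (h.symm.mul h).exists_norm_le
  refine ⟨√K, fun f => ?_⟩
  have h1 : ‖ι (T f)‖ ^ 2 ≤ K * ‖ι f‖ ^ 2 := by
    have h2 : ‖ι (T f)‖ ^ 2 = ‖inner ℂ (ι ((T' * T) f)) (ι f)‖ := by
      rw [mul_apply_eq_comp, h.symm, inner_self_eq_norm_sq_to_K]
      simp
    rw [h2, pow_two, ← mul_assoc]
    exact (norm_inner_le_norm _ _).trans (mul_le_mul_of_nonneg_right (hK f) (norm_nonneg _))
  refine (Real.le_sqrt_of_sq_le h1).trans (le_of_eq ?_)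
  rw [Real.sqrt_mul' _ (sq_nonneg _), Real.sqrt_sq (norm_nonneg _)]

/-- `T T⁺` extends to an operator on `L` of the form `W* W`. -/
theorem exists_extension [CompleteSpace L] (h : IsAdjointPairAlong ι T T') (hd : DenseRange ι) :
    ∃ W : L →L[ℂ] L, ∀ f, (star W * W) (ι f) = ι ((T * T') f) := by
  obtain ⟨K, hK⟩ := h.symm.exists_norm_le_of_pair
  set W : L →L[ℂ] L := ((ι.comp T' : E →L[ℂ] L) : E →ₗ[ℂ] L).extendOfNorm (ι : E →ₗ[ℂ] L)
  have hW : ∀ f, W (ι f) = ι (T' f) := fun f =>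
    LinearMap.extendOfNorm_eq (f := ((ι.comp T' : E →L[ℂ] L) : E →ₗ[ℂ] L))
      (e := (ι : E →ₗ[ℂ] L)) hd ⟨K, hK⟩ f
  refine ⟨W, fun f => hd.eq_of_inner_left ℂ fun x => ?_⟩
  rw [mul_apply_eq_comp, ContinuousLinearMap.star_eq_adjoint,
    ContinuousLinearMap.adjoint_inner_left, hW, hW, mul_apply_eq_comp, h]

end IsAdjointPairAlong

theorem mem_resolventSet_star_mul_self [CompleteSpace L] (W : L →L[ℂ] L) {z : ℂ} (hz : z.re < 0) :
    z ∈ resolventSet ℂ (star W * W) := by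
  by_contra hcon
  have hmem : z ∈ spectrum ℂ (star W * W) := hcon
  have hreal : z = z.re := (IsSelfAdjoint.star_mul_self W).mem_spectrum_eq_re hmem
  rw [hreal] at hmem
  have := spectrum_star_mul_self_nonneg (b := W) z.re
    (spectrum.of_algebraMap_mem ℂ (by simpa using hmem))
  linarith

/-- If `Q` has adjoint `Q'` and `Q + Q' - 1` is invertible, then the range of the projection `Q` is
compatible. -/
theorem isCompatibleSubspace_of_isUnit [CompleteSpace E] {ι : E →L[ℂ] L} (hι : Function.Injective ι)
    {S : Submodule ℂ E} (hS : IsClosed (S : Set E)) {Q Q' : E →L[ℂ] E}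
    (hQ : IsProperProjectionOnto ι Q S) (h : IsAdjointPairAlong ι Q Q')
    (hu : IsUnit (Q + Q' - 1)) : IsCompatibleSubspace ι hι S := by
  obtain ⟨-, hQQ, hrange⟩ := hQ
  have hQQ' : Q' * Q' = Q' := by
    have h1 := h.mul h
    rw [hQQ] at h1
    exact h1.eq hι h
  obtain ⟨B, hAB, hBA⟩ := isUnit_iff_exists.mp hu
  set A := Q + Q' - 1 with hA
  -- `A` intertwines `Q` and `Q'`, hence so does `B`; this makes `Q * B` self-adjoint.
  have hQA : Q * A = A * Q' := by
    simp only [hA, mul_sub, mul_add, sub_mul, add_mul, hQQ, hQQ', mul_one, one_mul]; abel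
  have hQA' : Q * A = Q * Q' := by
    simp only [hA, mul_sub, mul_add, hQQ, mul_one]; abel
  have hAQ : A * Q = Q' * A := by
    simp only [hA, mul_sub, mul_add, sub_mul, add_mul, hQQ, hQQ', mul_one, one_mul]; abel
  have hQB : Q * B = B * Q' := by
    calc Q * B = B * (A * Q) * B := by rw [← mul_assoc, hBA, one_mul]
      _ = B * Q' := by rw [hAQ, mul_assoc, mul_assoc, hAB, mul_one]
  have hBQ : B * Q = Q' * B := by
    calc B * Q = B * (Q * A) * B := by rw [mul_assoc, mul_assoc, hAB, mul_one]
      _ = Q' * B := by rw [hQA, ← mul_assoc, hBA, one_mul]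
  have hPQ : Q * B * Q = Q := by
    rw [mul_assoc, hBQ, ← mul_assoc, ← hQA', mul_assoc, hAB, mul_one]
  have hP : IsAdjointPairAlong ι (Q * B) (Q * B) := by
    have h1 := h.mul (h.add_sub_one.of_inverse hAB)
    rwa [← hQB] at h1
  refine ⟨hS, Q * B, ⟨hP.isProperOperator, ?_, ?_⟩, hP.isSymmetrizable hι⟩
  · rw [← mul_assoc, hPQ]
  · rw [← hrange]
    apply le_antisymm
    · rintro _ ⟨x, rfl⟩
      exact ⟨B x, rfl⟩
    · rintro _ ⟨x, rfl⟩
      exact ⟨Q x, DFunLike.congr_fun hPQ x⟩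

/-- If the spectrum of `X` is real and does not contain `0`, and `X` extends to an operator on `L`
whose resolvent set contains the open left half-plane, then the negative half-line lies in the
resolvent set of `X`. -/
theorem neg_mem_resolventSet_of_spectrum_real [CompleteSpace E] [CompleteSpace L]
    {ι : E →L[ℂ] L} (hι : Function.Injective ι) {X : E →L[ℂ] E} {Y : L →L[ℂ] L}
    (hXY : ∀ x, Y (ι x) = ι (X x)) (hY : ∀ z : ℂ, z.re < 0 → z ∈ resolventSet ℂ Y)
    (hX : IsUnit X) (hreal : ∀ z ∈ spectrum ℂ X, z.im = 0) {t : ℝ} (ht : 0 < t) :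
    (-t : ℂ) ∈ resolventSet ℂ X := by
  have h0 : (0 : ℂ) ∈ resolventSet ℂ X := by
    rw [spectrum.mem_resolventSet_iff, map_zero, zero_sub]
    exact hX.neg
  obtain ⟨ε, hε, hball⟩ := Metric.isOpen_iff.mp (spectrum.isOpen_resolventSet X) 0 h0
  obtain ⟨a, ha0, ha⟩ : ∃ a : ℝ, 0 < a ∧ a < min ε t := exists_between (lt_min hε ht)
  have haε := ha.trans_le (min_le_left _ _)
  have hat := ha.trans_le (min_le_right _ _)
  -- The circle has diameter `[-b, -a]`: `-a` is regular by closeness to `0`, `-b` by its size, and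
  -- `-t` lies between.
  set b : ℝ := ‖X‖ * ‖(1 : E →L[ℂ] E)‖ + t + 1 with hb
  have hXnn : 0 ≤ ‖X‖ * ‖(1 : E →L[ℂ] E)‖ := by positivity
  have htb : t < b := by linarith
  set c : ℝ := -(a + b) / 2 with hc
  set r : ℝ := (b - a) / 2 with hr
  have hr0 : 0 < r := by rw [hr]; linarith
  refine mem_resolventSet_of_sphere_subset hι hXY (c := (c : ℂ)) (r := r) ?_ ?_ ?_
  · intro z hz
    apply hY
    rw [Metric.mem_closedBall, Complex.dist_eq] at hz
    have h1 := (Complex.re_le_norm (z - c)).trans hz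
    rw [Complex.sub_re, Complex.ofReal_re] at h1
    linarith
  · intro z hz
    by_contra hcon
    have him := hreal z hcon
    have hzre : z = (z.re : ℂ) := Complex.ext rfl (by simpa using him)
    rw [hzre, Metric.mem_sphere, Complex.dist_eq, ← Complex.ofReal_sub, Complex.norm_real,
      Real.norm_eq_abs] at hz
    apply hcon
    rcases (abs_eq hr0.le).mp hz with h1 | h1
    · apply hball
      have h2 : z.re = -a := by linarith
      rw [hzre, h2, mem_ball_zero_iff, Complex.norm_real, Real.norm_eq_abs, abs_neg,
        abs_of_pos ha0]
      exact haε
    · apply spectrum.mem_resolventSet_of_norm_lt_mul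
      have h2 : z.re = -b := by linarith
      rw [hzre, h2, Complex.norm_real, Real.norm_eq_abs, abs_neg, abs_of_pos (by linarith)]
      linarith
  · rw [Metric.mem_ball, Complex.dist_eq, ← Complex.ofReal_neg, ← Complex.ofReal_sub,
      Complex.norm_real, Real.norm_eq_abs, abs_lt]
    constructor <;> linarith

end TwoNorms

theorem mainTheorem5 {E L : Type*}
    [NormedAddCommGroup E] [NormedSpace ℂ E] [CompleteSpace E]
    [NormedAddCommGroup L] [InnerProductSpace ℂ L] [CompleteSpace L]
    (ι : E →L[ℂ] L) (hι : Function.Injective ι) (hdense : DenseRange ι)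
    (S : Submodule ℂ E) (hS : IsProperSubspace ι S) (hS' : ¬ IsCompatibleSubspace ι hι S)
    (Q : E →L[ℂ] E) (hQ : IsProperProjectionOnto ι Q S)
    (V : E →L[ℂ] E) (hVQ : V = (2 : ℂ) • Q - 1) :
    ∃ hV : IsProperOperator ι V,
      IsSymmetrizable ι hι (V * properAdjoint ι hι V hV) ∧
      ∃ z ∈ spectrum ℂ (V * properAdjoint ι hι V hV), z.im ≠ 0 := by
  obtain ⟨hQp, hQQ, hrange⟩ := hQ
  have hQ' : IsAdjointPairAlong ι Q (properAdjoint ι hι Q hQp) := properAdjoint_spec ι hι Q hQp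
  set Q' := properAdjoint ι hι Q hQp
  have hpair : IsAdjointPairAlong ι V ((2 : ℂ) • Q' - 1) := by
    rw [hVQ]; exact hQ'.two_smul_sub_one
  refine ⟨hpair.isProperOperator, ?_⟩
  have hV' : properAdjoint ι hι V hpair.isProperOperator = (2 : ℂ) • Q' - 1 :=
    IsAdjointPairAlong.eq hι (properAdjoint_spec ι hι V hpair.isProperOperator) hpair
  rw [hV']
  set V' := (2 : ℂ) • Q' - 1 with hV'def
  have hX : IsAdjointPairAlong ι (V * V') (V * V') := hpair.mul hpair.symm
  refine ⟨hX.isSymmetrizable hι, ?_⟩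
  have hVV : V * V = 1 := by
    simp only [hVQ, mul_sub, sub_mul, smul_mul_smul_comm, hQQ, mul_one, one_mul]
    module
  have hVV' : V' * V' = 1 := by
    -- Uniqueness of the adjoint of `V * V = 1`.
    have h1 := hpair.mul hpair
    rw [hVV] at h1
    exact h1.eq hι fun x f => rfl
  by_contra! hreal
  obtain ⟨W, hW⟩ := hpair.exists_extension hdense
  have hVu : IsUnit V := isUnit_iff_exists.mpr ⟨V, hVV, hVV⟩
  have hV'u : IsUnit V' := isUnit_iff_exists.mpr ⟨V', hVV', hVV'⟩
  have h1 := neg_mem_resolventSet_of_spectrum_real hι hW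
    (fun z hz => mem_resolventSet_star_mul_self W hz) (hVu.mul hV'u) hreal one_pos
  have h2 : IsUnit (V * (1 + V * V')) := by
    refine hVu.mul ?_
    have h3 := (spectrum.mem_resolventSet_iff.mp h1).neg
    convert h3 using 1
    simp [add_comm]
  have h4 : V * (1 + V * V') = (2 : ℂ) • (Q + Q' - 1) := by
    rw [mul_add, mul_one, ← mul_assoc, hVV, one_mul, hVQ, hV'def]
    module
  rw [h4] at h2
  have h5 : IsUnit (Q + Q' - 1) := by
    have := h2.smul (Units.mk0 (2 : ℂ) two_ne_zero)⁻¹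
    simpa [Units.smul_def, smul_smul] using this
  exact hS' (isCompatibleSubspace_of_isUnit hι hS.1 ⟨hQp, hQQ, hrange⟩ hQ' h5)
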